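/- Let $X\subseteq\mathbb{N}$ be the set of all cardinalities $|A^*|$, where $A$ runs over the reduced rings with identity (that is, rings without nonzero nilpotent elements; $A$ may be infinite and need not be commutative) whose group of units $A^*$ is finite and abelian. Then $X$ has natural density $0$, i.e. the limit $$\lim_{n\to\infty}\frac{|X\cap\{1,\dots,n\}|}{n}$$ exists and equals $0$. -/

import Mathlib

universe u

/-- `X ⊆ ℕ` has natural density `d`: the limit of `|X ∩ {1, …, n}| / n` as `n → ∞` exists
and equals `d`. -/
def HasNaturalDensity (X : Set ℕ) (d : ℝ) : Prop :=
  Filter.Tendsto (fun n : ℕ => ((X ∩ Set.Icc 1 n).ncard : ℝ) / (n : ℝ)) Filter.atTop (nhds d)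

/-- The set of the cardinalities `|Aˣ|`, where `A` runs over the reduced rings with identity
(rings without nonzero nilpotent elements) whose group of units is finite and abelian.
The ring `A` itself may be infinite and is not required to be commutative. -/
def reducedUnitCards : Set ℕ :=
  {m : ℕ | ∃ (A : Type u) (_ : Ring A), IsReduced A ∧ Finite Aˣ ∧
    (∀ x y : Aˣ, x * y = y * x) ∧ Nat.card Aˣ = m}

/-! The units of `A` span a commutative reduced subring, finite over `ℤ`, with the same unit group.
Its torsion ideal is finite, hence generated by an idempotent, so the subring splits as torsion-free
times finite reduced. The finite factor is a product of fields and contributes a product of numbers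
`q - 1`. In the torsion-free factor a unit `u` of prime order `p ≥ 5` would make `1 - u + u ^ 2` a
unit of infinite order, so only the primes `2 = 3 - 1` and `3 = 4 - 1` divide the number of units.
Hence every cardinality lies in `primePowerPredMonoid`.

An element of that monoid is `e * d`, with `e` a product of even numbers `p - 1` and `d` a product
of numbers `a ^ k - 1`, `k ≥ 2`. With at least `K` factors in `e`, it is divisible by `2 ^ K`. With
at most `K`, Chebyshev's bound puts `e` in a set of density zero (`LogSparse`), and multiplying by
the `d`'s, whose reciprocals have finite sum, keeps density zero. Then `K` tends to infinity. -/

/-! ### Units of reduced rings -/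

/-- In a `ℤ`-torsion-free commutative ring, `1 - u + u ^ 2` is a unit for each `u` of odd order
prime to `3`. -/
theorem isUnit_one_sub_add_sq {R : Type*} [CommRing R] [IsAddTorsionFree R] {u : R} {n k : ℕ}
    (hn : Odd n) (hk : Odd k) (hu : u ^ n = 1) (huk : u ^ (3 * k) = u) :
    IsUnit (1 - u + u ^ 2) := by
  have hA := mul_neg_geom_sum (-u ^ 3) k
  have hB := mul_neg_geom_sum (-u) n
  rw [hk.neg_pow, ← pow_mul, huk] at hA
  rw [hn.neg_pow, hu] at hB
  refine IsUnit.of_mul_eq_one (∑ i ∈ Finset.range k, (-u ^ 3) ^ i) ?_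
  -- `hA` says that `1 + u` kills the bracket, because `1 + u ^ 3 = (1 + u) * (1 - u + u ^ 2)`; `hB`
  -- says that `1 + u` divides `2`.
  have h2 : (2 : ℕ) • ((1 - u + u ^ 2) * (∑ i ∈ Finset.range k, (-u ^ 3) ^ i) - 1) = 0 := by
    rw [two_nsmul]
    linear_combination (∑ i ∈ Finset.range n, (-u) ^ i) * hA
      - ((1 - u + u ^ 2) * (∑ i ∈ Finset.range k, (-u ^ 3) ^ i) - 1) * hB
  exact sub_eq_zero.mp ((smul_eq_zero_iff_right (by norm_num)).mp h2)

/-- `k` inverts `3` modulo `p`; adding an even multiple of `p` to `1` keeps `3 * k`, hence `k`, odd.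
-/
theorem exists_odd_three_mul_pow_eq {M : Type*} [Monoid M] {p : ℕ} (hp : p.Prime) (h5 : 5 ≤ p) :
    ∃ k, Odd k ∧ ∀ u : M, u ^ p = 1 → u ^ (3 * k) = u := by
  have h3 : p % 3 ≠ 0 := fun h =>
    by have := (Nat.prime_dvd_prime_iff_eq Nat.prime_three hp).mp (Nat.dvd_of_mod_eq_zero h); omega
  rcases (by omega : p % 3 = 1 ∨ p % 3 = 2) with h | h
  · refine ⟨(1 + 2 * p) / 3, Nat.odd_iff.mpr (by omega), fun u hu => ?_⟩
    rw [show 3 * ((1 + 2 * p) / 3) = p * 2 + 1 by omega, pow_succ, pow_mul, hu, one_pow, one_mul]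
  · refine ⟨(1 + 4 * p) / 3, Nat.odd_iff.mpr (by omega), fun u hu => ?_⟩
    rw [show 3 * ((1 + 4 * p) / 3) = p * 4 + 1 by omega, pow_succ, pow_mul, hu, one_pow, one_mul]

/-- On the unit circle `‖1 - ζ + ζ ^ 2‖ = |2 * ζ.re - 1|`. If this is `1`, then `ζ.re` is `0` or
`1`, which forces `ζ ^ 4 = 1`. -/
theorem IsPrimitiveRoot.one_sub_add_sq_pow_ne_one {ζ : ℂ} {p m : ℕ} (hζ : IsPrimitiveRoot ζ p)
    (hp : p.Prime) (h5 : 5 ≤ p) (hm : m ≠ 0) : (1 - ζ + ζ ^ 2) ^ m ≠ 1 := by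
  intro h
  have hζ1 : ‖ζ‖ = 1 := hζ.norm'_eq_one hp.ne_zero
  have hv : ‖1 - ζ + ζ ^ 2‖ = 1 := Complex.norm_eq_one_of_pow_eq_one h hm
  have hsq : ζ.re ^ 2 + ζ.im ^ 2 = 1 := by
    have := Complex.sq_norm ζ
    rw [hζ1, Complex.normSq_apply] at this
    linarith
  have hvsq : (1 - ζ.re + (ζ.re ^ 2 - ζ.im ^ 2)) ^ 2 + (-ζ.im + 2 * ζ.re * ζ.im) ^ 2 = 1 := by
    have := Complex.sq_norm (1 - ζ + ζ ^ 2)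
    rw [hv, Complex.normSq_apply] at this
    simp [pow_two] at this
    linarith
  have him : ζ.im ^ 2 = 1 - ζ.re ^ 2 := by linarith
  have hre : ζ.re * (ζ.re - 1) = 0 := by
    have : (1 - ζ.re + (ζ.re ^ 2 - ζ.im ^ 2)) ^ 2 + (-ζ.im + 2 * ζ.re * ζ.im) ^ 2
        = (2 * ζ.re - 1) ^ 2 := by
      have e : (-ζ.im + 2 * ζ.re * ζ.im) ^ 2 = ζ.im ^ 2 * (2 * ζ.re - 1) ^ 2 := by ring
      rw [e, him]; ring
    nlinarith
  have hz4 : ζ ^ 4 = 1 := by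
    rcases mul_eq_zero.mp hre with h0 | h1
    · have hz2 : ζ ^ 2 = -1 := by
        apply Complex.ext
        · simp [pow_two]; nlinarith
        · simp [pow_two, h0]
      rw [show ζ ^ 4 = (ζ ^ 2) ^ 2 by ring, hz2]; norm_num
    · have hr : ζ.re = 1 := by linarith
      have hi : ζ.im = 0 := by rw [hr] at him; nlinarith
      rw [show ζ = 1 from Complex.ext hr hi, one_pow]
  have := Nat.le_of_dvd (by norm_num) (hζ.dvd_of_pow_eq_one 4 hz4)
  omega

/-- In a `ℤ`-torsion-free commutative ring, `1 - u + u ^ 2` has infinite order for each `u` of prime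
order `p ≥ 5`. -/
theorem one_sub_add_sq_pow_ne_one {R : Type*} [CommRing R] [IsAddTorsionFree R] {u : R}
    {p m : ℕ} (hp : p.Prime) (h5 : 5 ≤ p) (hu : u ^ p = 1) (hu1 : u ≠ 1) (hm : m ≠ 0) :
    (1 - u + u ^ 2) ^ m ≠ 1 := by
  intro h
  have hflat : Module.Flat ℤ R := inferInstance
  let φ : R →ₐ[ℤ] TensorProduct ℤ ℚ R := Algebra.TensorProduct.includeRight
  have hφ : Function.Injective φ :=
    Algebra.TensorProduct.includeRight_injective (algebraMap ℤ ℚ).injective_int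
  let F : Polynomial ℚ := (1 - Polynomial.X + Polynomial.X ^ 2) ^ m - 1
  have hF : Polynomial.aeval (φ u) F = 0 := by
    simp only [F, map_sub, map_add, map_pow, map_one, Polynomial.aeval_X]
    rw [← map_one φ, ← map_pow φ u, ← map_sub, ← map_add, ← map_pow, h, sub_self]
  -- If `Φ_p ∣ F`, evaluation at a complex primitive root contradicts the previous lemma. Otherwise
  -- a Bézout relation evaluated at `u` and multiplied by `u - 1` gives `u = 1`.
  rcases dvd_or_isCoprime _ F (Polynomial.cyclotomic.irreducible_rat hp.pos) with hd | hc
  · have hζ := Complex.isPrimitiveRoot_exp p hp.ne_zero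
    apply hζ.one_sub_add_sq_pow_ne_one hp h5 hm
    obtain ⟨G, hG⟩ := hd
    have h0 : Polynomial.aeval (Complex.exp (2 * Real.pi * Complex.I / p))
        (Polynomial.cyclotomic p ℚ) = 0 := by
      have := hζ.isRoot_cyclotomic hp.pos
      rwa [Polynomial.aeval_def, ← Polynomial.eval_map, Polynomial.map_cyclotomic]
    have h1 := congrArg (Polynomial.aeval (Complex.exp (2 * Real.pi * Complex.I / p))) hG
    rw [map_mul, h0, zero_mul] at h1
    simpa [F, sub_eq_zero] using h1
  · obtain ⟨a, b, hab⟩ := hc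
    have hcyc : Polynomial.aeval (φ u) (Polynomial.cyclotomic p ℚ) * (φ u - 1) = 0 := by
      have := congrArg (Polynomial.aeval (φ u)) (Polynomial.cyclotomic_prime_mul_X_sub_one ℚ p
        (hn := ⟨hp⟩))
      have hup : φ u ^ p = 1 := by rw [← map_pow, hu, map_one]
      simpa only [map_mul, map_sub, map_pow, map_one, Polynomial.aeval_X, hup, sub_self] using this
    have h1 := congrArg (fun q => Polynomial.aeval (φ u) q * (φ u - 1)) hab
    simp only [map_add, map_mul, hF, mul_zero, add_zero, mul_assoc, hcyc, map_one, one_mul] at h1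
    apply hu1
    apply hφ
    rw [map_one]
    exact (sub_eq_zero.mp h1.symm)

theorem Nat.Prime.le_three_of_dvd_card_units {R : Type*} [CommRing R] [IsAddTorsionFree R]
    [Finite Rˣ] {p : ℕ} (hp : p.Prime) (hdvd : p ∣ Nat.card Rˣ) : p ≤ 3 := by
  by_contra hlt
  have h5 : 5 ≤ p := by
    have : p ≠ 4 := by rintro rfl; revert hp; decide
    omega
  have := Fact.mk hp
  obtain ⟨u, hu⟩ := exists_prime_orderOf_dvd_card' p hdvd
  have hup : (u : R) ^ p = 1 := by
    rw [← Units.val_pow_eq_pow_val, ← hu, pow_orderOf_eq_one, Units.val_one]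
  have hu1 : (u : R) ≠ 1 := fun h => by
    rw [Units.val_eq_one.mp h, orderOf_one] at hu
    omega
  obtain ⟨k, hk, hpow⟩ := exists_odd_three_mul_pow_eq (M := R) hp h5
  obtain ⟨v, hv⟩ := isUnit_one_sub_add_sq (hp.odd_of_ne_two (by omega)) hk hup (hpow u hup)
  refine one_sub_add_sq_pow_ne_one hp h5 hup hu1 (Nat.card_pos (α := Rˣ)).ne' ?_
  rw [← hv, ← Units.val_pow_eq_pow_val, pow_card_eq_one', Units.val_one]

/-! ### Unit counts: torsion-free, finite and general reduced rings -/

/-- The multiplicative monoid generated by the numbers `q - 1` with `q` a prime power. -/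
def primePowerPredMonoid : Submonoid ℕ :=
  Submonoid.closure {m | IsPrimePow (m + 1)}

theorem mem_primePowerPredMonoid_of_primeFactors_le {n : ℕ} (hn : n ≠ 0)
    (h : ∀ p, p.Prime → p ∣ n → p ≤ 3) : n ∈ primePowerPredMonoid := by
  rw [← Nat.prod_primeFactorsList hn]
  refine Submonoid.list_prod_mem _ fun p hp => Submonoid.subset_closure ?_
  have hpp := Nat.prime_of_mem_primeFactorsList hp
  have := h p hpp (Nat.dvd_of_mem_primeFactorsList hp)
  have := hpp.two_le
  rcases (by omega : p = 2 ∨ p = 3) with rfl | rfl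
  · exact Nat.prime_three.isPrimePow
  · exact (isPrimePow_nat_iff _).mpr ⟨2, 2, Nat.prime_two, by norm_num, by norm_num⟩

theorem card_units_mem_of_isAddTorsionFree (R : Type*) [CommRing R] [IsAddTorsionFree R]
    [Finite Rˣ] : Nat.card Rˣ ∈ primePowerPredMonoid :=
  mem_primePowerPredMonoid_of_primeFactors_le Nat.card_pos.ne'
    fun _ hp hd => hp.le_three_of_dvd_card_units hd

theorem card_units_mem_of_finite (R : Type*) [CommRing R] [Finite R] [IsReduced R] :
    Nat.card Rˣ ∈ primePowerPredMonoid := by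
  have e : Rˣ ≃ ∀ I : MaximalSpectrum R, (R ⧸ I.asIdeal)ˣ :=
    ((Units.mapEquiv (IsArtinianRing.equivPi R).toMulEquiv).trans MulEquiv.piUnits).toEquiv
  have := Fintype.ofFinite (MaximalSpectrum R)
  rw [Nat.card_congr e, Nat.card_pi]
  refine Submonoid.prod_mem _ fun I _ => Submonoid.subset_closure ?_
  have := I.isMaximal
  let := Ideal.Quotient.field I.asIdeal
  have : Finite (R ⧸ I.asIdeal) := Finite.of_surjective _ Ideal.Quotient.mk_surjective
  have := Fintype.ofFinite (R ⧸ I.asIdeal)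
  change IsPrimePow (_ + 1)
  rw [Nat.card_units, Nat.sub_add_cancel Nat.card_pos, Nat.card_eq_fintype_card]
  exact FiniteField.isPrimePow_card _

/-- The torsion elements of a commutative ring, as an ideal. -/
def torsionIdeal (R : Type*) [CommRing R] : Ideal R where
  carrier := Submodule.torsion ℤ R
  add_mem' := Submodule.add_mem _
  zero_mem' := Submodule.zero_mem _
  smul_mem' c x hx := by
    obtain ⟨a, ha⟩ := (Submodule.mem_torsion_iff x).mp hx
    exact (Submodule.mem_torsion_iff _).mpr ⟨a, by rw [smul_comm, ha, smul_zero]⟩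

theorem finite_torsionIdeal (R : Type*) [CommRing R] [Module.Finite ℤ R] :
    Finite (torsionIdeal R) :=
  Module.finite_of_fg_torsion (Submodule.torsion ℤ R) (Submodule.torsion_isTorsion)

/-- The powers of `t ∈ I` repeat, so `t * (1 - t ^ (k + 1))` is nilpotent, hence zero, and `t ∈ I *
I`. A finitely generated ideal equal to its square is generated by an idempotent. -/
theorem Ideal.exists_isIdempotentElem_of_finite {R : Type*} [CommRing R] [IsReduced R]
    (I : Ideal R) [Finite I] : ∃ e, IsIdempotentElem e ∧ I = Ideal.span {e} := by
  have hfg : I.FG := ⟨(Set.toFinite (I : Set R)).toFinset, by simp⟩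
  refine (I.isIdempotentElem_iff_of_fg hfg).mp (le_antisymm Ideal.mul_le_left fun t ht => ?_)
  obtain ⟨i, j, hij, h⟩ := Finite.exists_ne_map_eq_of_infinite
    (fun i : ℕ => (⟨t ^ (i + 1), I.pow_mem_of_mem ht _ i.succ_pos⟩ : I))
  simp only [Subtype.mk.injEq] at h
  wlog hlt : i < j generalizing i j
  · exact this j i hij.symm h.symm (by omega)
  obtain ⟨k, rfl⟩ := Nat.exists_eq_add_of_lt hlt
  have h0 : (t * (1 - t ^ (k + 1))) ^ (i + 1) = 0 := by
    rw [mul_pow, pow_succ' (1 - t ^ (k + 1)), ← mul_assoc, mul_sub, mul_one, ← pow_add,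
      show i + 1 + (k + 1) = i + k + 1 + 1 by ring, ← h, sub_self, zero_mul]
  have h1 := pow_eq_zero_iff (by omega) |>.mp h0
  have h2 : t = t * t ^ (k + 1) := by linear_combination h1
  rw [h2]
  exact Ideal.mul_mem_mul ht (I.pow_mem_of_mem ht _ k.succ_pos)

theorem card_units_mem_of_module_finite (R : Type*) [CommRing R] [IsReduced R]
    [Module.Finite ℤ R] [Finite Rˣ] : Nat.card Rˣ ∈ primePowerPredMonoid := by
  have := finite_torsionIdeal R
  obtain ⟨e, he, hT⟩ := (torsionIdeal R).exists_isIdempotentElem_of_finite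
  let I : Ideal R := Ideal.span {e}
  let J : Ideal R := Ideal.span {1 - e}
  have hIJ : IsCoprime I J := (Ideal.isCoprime_span_singleton_iff _ _).mpr ⟨1, 1, by ring⟩
  have hmul : I * J = ⊥ := by
    rw [Ideal.span_singleton_mul_span_singleton, mul_sub, mul_one, he.eq, sub_self]
    simp
  have eR : R ≃+* (R ⧸ I) × (R ⧸ J) :=
    (RingEquiv.quotientBot R).symm.trans ((Ideal.quotEquivOfEq hmul.symm).trans
      (Ideal.quotientMulEquivQuotientProd I J hIJ))
  have eU : Rˣ ≃* (R ⧸ I)ˣ × (R ⧸ J)ˣ := (Units.mapEquiv eR.toMulEquiv).trans MulEquiv.prodUnits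
  have : IsAddTorsionFree (R ⧸ I) := by
    rw [← Module.isTorsionFree_int_iff_isAddTorsionFree, Module.isTorsionFree_iff_smul_eq_zero]
    intro n x hx
    obtain ⟨x, rfl⟩ := Ideal.Quotient.mk_surjective x
    by_cases hn : n = 0
    · exact Or.inl hn
    right
    rw [← map_zsmul, Ideal.Quotient.eq_zero_iff_mem, ← show _ = I from hT] at hx
    rw [Ideal.Quotient.eq_zero_iff_mem, ← show _ = I from hT]
    obtain ⟨a, ha⟩ := (Submodule.mem_torsion_iff _).mp hx
    exact (Submodule.mem_torsion_iff _).mpr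
      ⟨a * ⟨n, mem_nonZeroDivisors_of_ne_zero hn⟩, by rw [mul_smul]; exact ha⟩
  have : IsReduced (R ⧸ J) := by
    refine ⟨fun x ⟨n, hx⟩ => ?_⟩
    obtain ⟨x, rfl⟩ := Ideal.Quotient.mk_surjective x
    rw [← map_pow, Ideal.Quotient.eq_zero_iff_mem, Ideal.mem_span_singleton] at hx
    obtain ⟨c, hc⟩ := hx
    -- The exponent `n + 1` covers `n = 0`, where `e ^ n = e` may fail.
    have h0 : (e * x) ^ (n + 1) = 0 := by
      rw [mul_pow, pow_succ x, hc, he.pow_succ_eq]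
      linear_combination (-c * x) * he.eq
    have h1 := pow_eq_zero_iff (by omega) |>.mp h0
    rw [Ideal.Quotient.eq_zero_iff_mem, Ideal.mem_span_singleton]
    exact ⟨x, by linear_combination h1⟩
  -- Modulo `1 - e` every `x` equals `e * x`, which is torsion.
  have : Finite (R ⧸ J) := by
    refine Finite.of_surjective (fun t : torsionIdeal R => Ideal.Quotient.mk J t) fun x => ?_
    obtain ⟨x, rfl⟩ := Ideal.Quotient.mk_surjective x
    refine ⟨⟨e * x, hT ▸ Ideal.mem_span_singleton.mpr ⟨x, rfl⟩⟩, ?_⟩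
    rw [Ideal.Quotient.eq, Ideal.mem_span_singleton]
    exact ⟨-x, by ring⟩
  have : Finite ((R ⧸ I)ˣ × (R ⧸ J)ˣ) := Finite.of_equiv _ eU.toEquiv
  have : Finite (R ⧸ I)ˣ := Finite.of_surjective (Prod.fst : (R ⧸ I)ˣ × (R ⧸ J)ˣ → _)
    Prod.fst_surjective
  rw [Nat.card_congr eU.toEquiv, Nat.card_prod]
  exact mul_mem (card_units_mem_of_isAddTorsionFree _) (card_units_mem_of_finite _)

-- The units are closed under products, so the subring they generate is their `ℤ`-span, which is
-- finitely generated; it contains all inverses, so no unit is lost.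
open scoped IsMulCommutative in
theorem card_units_mem_of_isReduced (A : Type*) [Ring A] [IsReduced A] [Finite Aˣ]
    (hcomm : ∀ x y : Aˣ, x * y = y * x) : Nat.card Aˣ ∈ primePowerPredMonoid := by
  let s : Set A := (IsUnit.submonoid A : Set A)
  have hs : s.Finite := (Set.finite_range (Units.val : Aˣ → A)).subset fun _ ⟨u, hu⟩ => ⟨u, hu⟩
  have hsc : ∀ a ∈ s, ∀ b ∈ s, a * b = b * a := by
    rintro _ ⟨a, rfl⟩ _ ⟨b, rfl⟩
    exact congrArg Units.val (hcomm a b)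
  let R := Algebra.adjoin ℤ s
  have := Algebra.isMulCommutative_adjoin ℤ hsc
  let : CommRing R := inferInstance
  have : Module.Finite ℤ R := by
    refine Module.Finite.iff_fg (N := Subalgebra.toSubmodule R).mpr ?_
    rw [Algebra.adjoin_eq_span, Submonoid.closure_eq]
    exact Submodule.fg_span hs
  have : IsReduced R := isReduced_of_injective R.val Subtype.val_injective
  have e : Rˣ ≃ Aˣ :=
    { toFun := Units.map (R.val : R →* A)
      invFun := fun u => ⟨⟨u, Algebra.subset_adjoin u.isUnit⟩,
        ⟨(u⁻¹ : Aˣ), Algebra.subset_adjoin u⁻¹.isUnit⟩,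
        Subtype.ext u.mul_inv, Subtype.ext u.inv_mul⟩
      left_inv := fun u => Units.ext (Subtype.ext rfl)
      right_inv := fun u => Units.ext rfl }
  have : Finite Rˣ := Finite.of_equiv _ e.symm
  rw [← Nat.card_congr e]
  exact card_units_mem_of_module_finite R

theorem reducedUnitCards_subset : reducedUnitCards.{u} ⊆ primePowerPredMonoid := by
  rintro _ ⟨A, _, _, _, hcomm, rfl⟩
  exact card_units_mem_of_isReduced A hcomm


open scoped Pointwise

/-! ### Sets of natural density zero -/

theorem ncard_inter_Icc_le (X : Set ℕ) (n : ℕ) : (X ∩ Set.Icc 1 n).ncard ≤ n := by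
  refine (Set.ncard_le_ncard Set.inter_subset_right (Set.finite_Icc 1 n)).trans ?_
  rw [← Finset.coe_Icc, Set.ncard_coe_finset, Nat.card_Icc, Nat.add_sub_cancel]

/-- Sorting products by `d` bounds the proportion by a sum over `d ∈ D` of terms that tend to `0`
and are at most `1 / d`; dominated convergence applies. -/
theorem HasNaturalDensity.mul_of_summable {E D : Set ℕ} (hE : HasNaturalDensity E 0)
    (hD : Summable (D.indicator fun d : ℕ => (1 : ℝ) / d)) : HasNaturalDensity (E * D) 0 := by
  classical
  let f : ℕ → ℕ → ℝ := fun n => D.indicator fun d => ((E ∩ Set.Icc 1 (n / d)).ncard : ℝ) / n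
  have hf0 : ∀ n d, 0 ≤ f n d := fun n d => Set.indicator_nonneg (fun _ _ => by positivity) d
  have hfb : ∀ n d, f n d ≤ D.indicator (fun d : ℕ => (1 : ℝ) / d) d := by
    refine fun n d => Set.indicator_le_indicator ?_
    rcases Nat.eq_zero_or_pos n with rfl | hn
    · simp
    · have h1 : ((E ∩ Set.Icc 1 (n / d)).ncard : ℝ) ≤ (n : ℝ) / d :=
        (Nat.cast_le.mpr (ncard_inter_Icc_le E _)).trans Nat.cast_div_le
      calc _ ≤ (n : ℝ) / d / n := by gcongr
        _ = 1 / d := by field_simp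
  have hlim : ∀ d, Filter.Tendsto (f · d) Filter.atTop (nhds 0) := by
    intro d
    by_cases hd : d ∈ D
    · simp only [f, Set.indicator_of_mem hd]
      rcases Nat.eq_zero_or_pos d with rfl | hd0
      · simp
      · refine squeeze_zero (fun n => by positivity) (fun n => ?_)
          (hE.comp (Nat.tendsto_div_const_atTop hd0.ne'))
        rcases Nat.eq_zero_or_pos (n / d) with h | h
        · simp [h]
        · have : ((n / d : ℕ) : ℝ) ≤ n := Nat.cast_le.mpr (Nat.div_le_self n d)
          simp only [Function.comp_apply]
          gcongr
    · simp [f, Set.indicator_of_notMem hd]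
  have htan := tendsto_tsum_of_dominated_convergence hD hlim
    (Filter.Eventually.of_forall fun n d => by
      rw [Real.norm_of_nonneg (hf0 n d)]; exact hfb n d)
  rw [tsum_zero] at htan
  refine squeeze_zero (fun n => by positivity) (fun n => ?_) htan
  have hsub : (E * D) ∩ Set.Icc 1 n ⊆
      ⋃ d ∈ (Finset.Icc 1 n).filter (· ∈ D), (· * d) '' (E ∩ Set.Icc 1 (n / d)) := by
    rintro _ ⟨⟨e, he, d, hd, rfl⟩, h1, hn⟩
    have he0 : 0 < e := Nat.pos_of_mul_pos_right h1
    have hd0 : 0 < d := Nat.pos_of_mul_pos_left h1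
    simp only [Set.mem_iUnion]
    refine ⟨d, Finset.mem_filter.mpr ⟨Finset.mem_Icc.mpr ⟨hd0, ?_⟩, hd⟩, e,
      ⟨he, he0, (Nat.le_div_iff_mul_le hd0).mpr hn⟩, rfl⟩
    exact (Nat.le_mul_of_pos_left d he0).trans hn
  have hcard : ((E * D) ∩ Set.Icc 1 n).ncard ≤
      ∑ d ∈ (Finset.Icc 1 n).filter (· ∈ D), (E ∩ Set.Icc 1 (n / d)).ncard := by
    refine (Set.ncard_le_ncard hsub (Set.Finite.biUnion (Finset.finite_toSet _) fun d _ =>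
      ((Set.finite_Icc _ _).inter_of_right _).image _)).trans
      ((Finset.set_ncard_biUnion_le _ _).trans (Finset.sum_le_sum fun d _ => ?_))
    exact Set.ncard_image_le ((Set.finite_Icc _ _).inter_of_right _)
  calc (((E * D) ∩ Set.Icc 1 n).ncard : ℝ) / n
      ≤ (∑ d ∈ (Finset.Icc 1 n).filter (· ∈ D), ((E ∩ Set.Icc 1 (n / d)).ncard : ℝ)) / n := by
        gcongr
        exact_mod_cast hcard
    _ = ∑ d ∈ (Finset.Icc 1 n).filter (· ∈ D), f n d := by
        rw [Finset.sum_div]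
        refine Finset.sum_congr rfl fun d hd => ?_
        simp only [f]
        rw [Set.indicator_of_mem (Finset.mem_filter.mp hd).2]
    _ ≤ ∑' d, f n d := Summable.sum_le_tsum _ (fun d _ => hf0 n d)
        (Summable.of_nonneg_of_le (hf0 n) (hfb n) hD)

/-! ### Reciprocal sums over multiplicative monoids -/

/-- An Euler product bound by `∏ (1 - 1 / f i)⁻¹`. Truncating at `N` keeps the sums finite, so the
recursion `hrec` can be solved for the larger sum. -/
theorem Submonoid.sum_closure_image_le {ι : Type*} {f : ι → ℕ} (hf : ∀ i, 2 ≤ f i)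
    (F : Finset ι) (N : ℕ) :
    ∑ d ∈ Finset.range N, (Submonoid.closure (f '' F) : Set ℕ).indicator
      (fun d : ℕ => (1 : ℝ) / d) d ≤ Real.exp (∑ i ∈ F, 2 * (1 / (f i : ℝ))) := by
  classical
  induction F using Finset.induction_on generalizing N with
  | empty =>
    have h : ∀ d : ℕ, (Submonoid.closure (f '' (∅ : Finset ι)) : Set ℕ).indicator
        (fun d : ℕ => (1 : ℝ) / d) d ≤ if d = 1 then 1 else 0 := by
      intro d
      by_cases hd : d = 1
      · subst hd
        simp
      · simp [hd]
    refine (Finset.sum_le_sum fun d _ => h d).trans ?_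
    rw [Finset.sum_ite_eq']
    split_ifs <;> simp
  | insert i F hi ih =>
    set M := Submonoid.closure (f '' F) with hM
    set M' := Submonoid.closure (f '' (insert i F : Finset ι)) with hM'
    have hs0 : 0 < f i := (by norm_num : 0 < 2).trans_le (hf i)
    have hmem : ∀ d ∈ M', d ∈ M ∨ ∃ e ∈ M', f i * e = d := by
      intro d hd
      rw [hM', Finset.coe_insert, Set.image_insert_eq, Set.insert_eq, Submonoid.closure_union,
        Submonoid.mem_sup] at hd
      obtain ⟨y, hy, z, hz, rfl⟩ := hd
      obtain ⟨k, rfl⟩ := Submonoid.mem_closure_singleton.mp hy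
      cases k with
      | zero => left; simpa using hz
      | succ k =>
        refine Or.inr ⟨f i ^ k * z, mul_mem
          (pow_mem (Submonoid.subset_closure (Set.mem_image_of_mem f (by simp))) _)
          (Submonoid.closure_mono (Set.image_mono (by simp)) hz), by ring⟩
    let g : Submonoid ℕ → ℕ → ℝ := fun K => (K : Set ℕ).indicator fun d : ℕ => (1 : ℝ) / d
    have hg0 : ∀ K d, 0 ≤ g K d := fun K d => Set.indicator_nonneg (fun _ _ => by positivity) d
    have hrec : ∑ d ∈ Finset.range N, g M' d ≤
        ∑ d ∈ Finset.range N, g M d + 1 / f i * ∑ d ∈ Finset.range N, g M' d := by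
      have h1 : ∀ d ∈ Finset.range N, g M' d ≤ g M d +
          ∑ e ∈ Finset.range N, if f i * e = d then 1 / f i * g M' e else 0 := by
        intro d hdN
        have hnn : ∀ e ∈ Finset.range N,
            0 ≤ if f i * e = d then 1 / (f i : ℝ) * g M' e else 0 := fun e _ => by
          split_ifs
          · exact mul_nonneg (by positivity) (hg0 _ _)
          · exact le_rfl
        by_cases hd : d ∈ M'
        · rcases hmem d hd with h | ⟨e, he, rfl⟩
          · have : g M' d = g M d := by
              simp only [g]
              rw [Set.indicator_of_mem (show d ∈ (M' : Set ℕ) from hd),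
                Set.indicator_of_mem (show d ∈ (M : Set ℕ) from h)]
            rw [this]
            exact le_add_of_nonneg_right (Finset.sum_nonneg hnn)
          · have heN : e ∈ Finset.range N := Finset.mem_range.mpr
              ((Nat.le_mul_of_pos_left e hs0).trans_lt (Finset.mem_range.mp hdN))
            refine le_add_of_nonneg_of_le (hg0 _ _) (le_trans (le_of_eq ?_)
              (Finset.single_le_sum hnn heN))
            simp only [g, if_true]
            rw [Set.indicator_of_mem (show f i * e ∈ (M' : Set ℕ) from hd),
              Set.indicator_of_mem (show e ∈ (M' : Set ℕ) from he)]
            push_cast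
            rw [one_div_mul_one_div]
        · have : g M' d = 0 := Set.indicator_of_notMem (s := (M' : Set ℕ)) hd _
          rw [this]
          exact add_nonneg (hg0 _ _) (Finset.sum_nonneg hnn)
      refine (Finset.sum_le_sum h1).trans ?_
      rw [Finset.sum_add_distrib, Finset.sum_comm, Finset.mul_sum]
      gcongr with e he
      rw [Finset.sum_ite_eq]
      split_ifs
      · exact le_rfl
      · exact mul_nonneg (by positivity) (hg0 _ _)
    have hS0 : 0 ≤ ∑ d ∈ Finset.range N, g M' d := Finset.sum_nonneg fun d _ => hg0 _ _
    rw [Finset.sum_insert hi, Real.exp_add]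
    have ht : (1 : ℝ) / f i ≤ 1 / 2 := by
      have : (2 : ℝ) ≤ f i := by exact_mod_cast hf i
      gcongr
    have ht0 : (0 : ℝ) ≤ 1 / f i := by positivity
    -- With `t = 1 / f i ≤ 1 / 2`: `exp (2t) * (1 - t) ≥ (1 + 2t) * (1 - t) = 1 + t * (1 - 2t)`.
    have hexp : 1 ≤ Real.exp (2 * (1 / (f i : ℝ))) * (1 - 1 / f i) := by
      have := Real.add_one_le_exp (2 * (1 / (f i : ℝ)))
      nlinarith
    calc ∑ d ∈ Finset.range N, g M' d
        ≤ (Real.exp (2 * (1 / (f i : ℝ))) * (1 - 1 / f i)) * ∑ d ∈ Finset.range N, g M' d :=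
          le_mul_of_one_le_left hS0 hexp
      _ = Real.exp (2 * (1 / (f i : ℝ))) * ((1 - 1 / f i) * ∑ d ∈ Finset.range N, g M' d) := by
          ring
      _ ≤ _ := by
          gcongr
          exact le_trans (by linarith) (ih N)

theorem Submonoid.summable_closure_range {ι : Type*} {f : ι → ℕ} (hf : ∀ i, 2 ≤ f i)
    (hs : Summable fun i => (1 : ℝ) / f i) :
    Summable ((Submonoid.closure (Set.range f) : Set ℕ).indicator fun d : ℕ => (1 : ℝ) / d) := by
  classical
  have hfin : ∀ d ∈ Submonoid.closure (Set.range f),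
      ∃ F : Finset ι, d ∈ Submonoid.closure (f '' F) := by
    intro d hd
    induction hd using Submonoid.closure_induction with
    | mem x hx =>
      obtain ⟨i, rfl⟩ := hx
      exact ⟨{i}, Submonoid.subset_closure ⟨i, by simp, rfl⟩⟩
    | one => exact ⟨∅, one_mem _⟩
    | mul x y _ _ hx hy =>
      obtain ⟨F, hF⟩ := hx
      obtain ⟨G, hG⟩ := hy
      exact ⟨F ∪ G, mul_mem (Submonoid.closure_mono (Set.image_mono (by simp)) hF)
        (Submonoid.closure_mono (Set.image_mono (by simp)) hG)⟩
  choose! F hF using hfin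
  refine summable_of_sum_le (c := Real.exp (∑' i, 2 * (1 / (f i : ℝ))))
    (fun d => Set.indicator_nonneg (fun _ _ => by positivity) d) fun u => ?_
  have h1 := Submonoid.sum_closure_image_le hf (u.biUnion F) (u.sup id + 1)
  refine le_trans ?_ (h1.trans (Real.exp_le_exp.mpr
    (Summable.sum_le_tsum _ (fun _ _ => by positivity) (hs.mul_left 2))))
  refine le_trans (Finset.sum_le_sum fun d hd => ?_) (Finset.sum_le_sum_of_subset_of_nonneg
    (fun d hd => Finset.mem_range.mpr (Nat.lt_succ_of_le (Finset.le_sup (f := id) hd)))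
    fun d _ _ => Set.indicator_nonneg (fun _ _ => by positivity) d)
  by_cases hdm : d ∈ (Submonoid.closure (Set.range f) : Set ℕ)
  · rw [Set.indicator_of_mem hdm, Set.indicator_of_mem]
    exact Submonoid.closure_mono (Set.image_mono (by
      exact_mod_cast Finset.subset_biUnion_of_mem F hd)) (hF d hdm)
  · rw [Set.indicator_of_notMem hdm]
    exact Set.indicator_nonneg (fun _ _ => by positivity) d

/-! ### Sparse sets and their products -/

/-- Up to powers of `log log x`, the set `S` has at most `x / log x` elements below `x`. -/
def LogSparse (S : Set ℕ) : Prop :=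
  ∃ (C : ℝ) (c : ℕ), ∀ m : ℕ, ((S ∩ Set.Ioo 0 (2 ^ (m + 1))).ncard : ℝ) ≤
    C * 2 ^ m * (1 + Real.log (m + 1)) ^ c / (m + 1)

/-- Partial fractions: `1 / (a * b) = (1 / a + 1 / b) / (a + b)` with `a + b = m + 2`, leaving two
equal harmonic sums. -/
theorem sum_range_one_div_mul_le (m : ℕ) :
    ∑ i ∈ Finset.range (m + 1), 1 / (((i : ℝ) + 1) * (((m - i : ℕ) : ℝ) + 1)) ≤
      2 * (1 + Real.log (m + 1)) / (m + 1) := by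
  have hharm : ∑ i ∈ Finset.range (m + 1), 1 / ((i : ℝ) + 1) ≤ 1 + Real.log (m + 1) := by
    have := harmonic_le_one_add_log (m + 1)
    simp only [harmonic] at this
    push_cast at this
    simpa only [one_div] using this
  have hrefl : ∑ i ∈ Finset.range (m + 1), 1 / (((m - i : ℕ) : ℝ) + 1) =
      ∑ i ∈ Finset.range (m + 1), 1 / ((i : ℝ) + 1) := by
    simpa using Finset.sum_range_reflect (fun i : ℕ => 1 / ((i : ℝ) + 1)) (m + 1)
  calc _ = (∑ i ∈ Finset.range (m + 1), 1 / ((i : ℝ) + 1) +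
        ∑ i ∈ Finset.range (m + 1), 1 / (((m - i : ℕ) : ℝ) + 1)) / (m + 2) := by
        rw [← Finset.sum_add_distrib, Finset.sum_div]
        refine Finset.sum_congr rfl fun i hi => ?_
        rw [Nat.cast_sub (Nat.lt_succ_iff.mp (Finset.mem_range.mp hi))]
        have : (i : ℝ) ≤ m := by exact_mod_cast Nat.lt_succ_iff.mp (Finset.mem_range.mp hi)
        have h1 : (m : ℝ) - i + 1 ≠ 0 := by linarith
        field_simp
        ring
    _ = 2 * (∑ i ∈ Finset.range (m + 1), 1 / ((i : ℝ) + 1)) / (m + 2) := by rw [hrefl]; ring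
    _ ≤ 2 * (1 + Real.log (m + 1)) / (m + 1) := by
        have hl : 0 ≤ Real.log (m + 1) := Real.log_nonneg (by linarith [Nat.cast_nonneg (α := ℝ) m])
        gcongr
        norm_num

/-- Here `i` is the binary logarithm of the factor from `S`; `2 ^ i ≤ s` then bounds the other
factor. -/
theorem ncard_mul_inter_Ioo_le (S T : Set ℕ) (m : ℕ) :
    ((S * T) ∩ Set.Ioo 0 (2 ^ (m + 1))).ncard ≤ ∑ i ∈ Finset.range (m + 1),
      (S ∩ Set.Ioo 0 (2 ^ (i + 1))).ncard * (T ∩ Set.Ioo 0 (2 ^ (m - i + 1))).ncard := by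
  have hsub : (S * T) ∩ Set.Ioo 0 (2 ^ (m + 1)) ⊆ ⋃ i ∈ Finset.range (m + 1),
      (fun p : ℕ × ℕ => p.1 * p.2) ''
        ((S ∩ Set.Ioo 0 (2 ^ (i + 1))) ×ˢ (T ∩ Set.Ioo 0 (2 ^ (m - i + 1)))) := by
    rintro _ ⟨⟨s, hs, t, ht, rfl⟩, h0, hlt⟩
    have hs0 : 0 < s := Nat.pos_of_mul_pos_right h0
    have ht0 : 0 < t := Nat.pos_of_mul_pos_left h0
    have hlog : 2 ^ Nat.log 2 s ≤ s := Nat.pow_log_le_self 2 hs0.ne'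
    have hi : Nat.log 2 s < m + 1 := (Nat.log_lt_iff_lt_pow (by norm_num) hs0.ne').mpr
      ((Nat.le_mul_of_pos_right s ht0).trans_lt hlt)
    simp only [Set.mem_iUnion]
    refine ⟨Nat.log 2 s, Finset.mem_range.mpr hi, (s, t),
      ⟨⟨hs, hs0, Nat.lt_pow_succ_log_self (by norm_num) s⟩, ht, ht0, ?_⟩, rfl⟩
    refine lt_of_mul_lt_mul_left (a := 2 ^ Nat.log 2 s) ?_ (Nat.zero_le _)
    rw [← pow_add, show Nat.log 2 s + (m - Nat.log 2 s + 1) = m + 1 by omega]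
    exact (Nat.mul_le_mul_right t hlog).trans_lt hlt
  have hfin : ∀ (X : Set ℕ) (n : ℕ), (X ∩ Set.Ioo 0 n).Finite :=
    fun X n => (Set.finite_Ioo _ _).inter_of_right _
  refine (Set.ncard_le_ncard hsub (Set.Finite.biUnion (Finset.finite_toSet _) fun i _ =>
    ((hfin _ _).prod (hfin _ _)).image _)).trans
    ((Finset.set_ncard_biUnion_le _ _).trans (Finset.sum_le_sum fun i _ => ?_))
  exact (Set.ncard_image_le ((hfin _ _).prod (hfin _ _))).trans Set.ncard_prod.le

theorem LogSparse.mul {S T : Set ℕ} (hS : LogSparse S) (hT : LogSparse T) :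
    LogSparse (S * T) := by
  obtain ⟨C, c, hC⟩ := hS
  obtain ⟨B, b, hB⟩ := hT
  -- At `m = 0` the bound is `C` itself, as `log 1 = 0`.
  have hC0 : 0 ≤ C := by simpa using (Nat.cast_nonneg _).trans (hC 0)
  have hB0 : 0 ≤ B := by simpa using (Nat.cast_nonneg _).trans (hB 0)
  refine ⟨2 * C * B, c + b + 1, fun m => ?_⟩
  have hL0 : ∀ k : ℕ, 0 ≤ Real.log (k + 1) := fun k =>
    Real.log_nonneg (by linarith [Nat.cast_nonneg (α := ℝ) k])
  have hL : ∀ k ≤ m, 1 + Real.log (k + 1) ≤ 1 + Real.log (m + 1) := fun k hk => by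
    gcongr
  calc (((S * T) ∩ Set.Ioo 0 (2 ^ (m + 1))).ncard : ℝ)
      ≤ ∑ i ∈ Finset.range (m + 1), ((S ∩ Set.Ioo 0 (2 ^ (i + 1))).ncard : ℝ) *
          (T ∩ Set.Ioo 0 (2 ^ (m - i + 1))).ncard := by
        exact_mod_cast ncard_mul_inter_Ioo_le S T m
    _ ≤ ∑ i ∈ Finset.range (m + 1), C * B * 2 ^ m * (1 + Real.log (m + 1)) ^ (c + b) *
          (1 / (((i : ℝ) + 1) * (((m - i : ℕ) : ℝ) + 1))) := by
        refine Finset.sum_le_sum fun i hi => ?_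
        have him : i ≤ m := Nat.lt_succ_iff.mp (Finset.mem_range.mp hi)
        have h1 : ((S ∩ Set.Ioo 0 (2 ^ (i + 1))).ncard : ℝ) ≤
            C * 2 ^ i * (1 + Real.log (m + 1)) ^ c / (i + 1) := by
          refine (hC i).trans ?_
          have := hL0 i
          have := hL i him
          gcongr
        have h2 : ((T ∩ Set.Ioo 0 (2 ^ (m - i + 1))).ncard : ℝ) ≤
            B * 2 ^ (m - i) * (1 + Real.log (m + 1)) ^ b / (((m - i : ℕ) : ℝ) + 1) := by
          refine (hB (m - i)).trans ?_
          have := hL0 (m - i)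
          have := hL (m - i) (Nat.sub_le _ _)
          gcongr
        have h0 := hL0 m
        refine (mul_le_mul h1 h2 (by positivity) (by positivity)).trans (le_of_eq ?_)
        have : (2 : ℝ) ^ m = 2 ^ i * 2 ^ (m - i) := by rw [← pow_add, Nat.add_sub_cancel' him]
        rw [this, pow_add]
        field_simp
    _ ≤ C * B * 2 ^ m * (1 + Real.log (m + 1)) ^ (c + b) *
          (2 * (1 + Real.log (m + 1)) / (m + 1)) := by
        rw [← Finset.mul_sum]
        have h0 := hL0 m
        gcongr
        exact sum_range_one_div_mul_le m
    _ = _ := by ring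

theorem LogSparse.insert_one {S : Set ℕ} (hS : LogSparse S) : LogSparse (insert 1 S) := by
  obtain ⟨C, c, hC⟩ := hS
  refine ⟨C + 1, c, fun m => ?_⟩
  have hL0 : 0 ≤ Real.log (m + 1) :=
    Real.log_nonneg (by linarith [Nat.cast_nonneg (α := ℝ) m])
  have hsub : insert 1 S ∩ Set.Ioo 0 (2 ^ (m + 1)) ⊆ insert 1 (S ∩ Set.Ioo 0 (2 ^ (m + 1))) := by
    rintro x ⟨rfl | hx, h⟩
    · exact Or.inl rfl
    · exact Or.inr ⟨hx, h⟩
  have h1 : ((insert 1 S ∩ Set.Ioo 0 (2 ^ (m + 1))).ncard : ℝ) ≤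
      (S ∩ Set.Ioo 0 (2 ^ (m + 1))).ncard + 1 := by
    exact_mod_cast (Set.ncard_le_ncard hsub
      (((Set.finite_Ioo _ _).inter_of_right _).insert _)).trans (Set.ncard_insert_le _ _)
  have h2 : (1 : ℝ) ≤ 2 ^ m * (1 + Real.log (m + 1)) ^ c / (m + 1) := by
    rw [le_div_iff₀ (by positivity), one_mul]
    have h3 : (m : ℝ) + 1 ≤ 2 ^ m := by exact_mod_cast Nat.lt_two_pow_self
    exact h3.trans (le_mul_of_one_le_right (by positivity) (one_le_pow₀ (by linarith)))
  calc _ ≤ _ := h1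
    _ ≤ C * 2 ^ m * (1 + Real.log (m + 1)) ^ c / (m + 1) +
        2 ^ m * (1 + Real.log (m + 1)) ^ c / (m + 1) := add_le_add (hC m) h2
    _ = _ := by ring

theorem LogSparse.pow_insert_one {S : Set ℕ} (hS : LogSparse S) (k : ℕ) :
    LogSparse (insert 1 S ^ k) := by
  induction k with
  | zero =>
    have : LogSparse ∅ := ⟨0, 0, fun m => by simp⟩
    rw [pow_zero, ← Set.singleton_one, ← insert_empty_eq]
    exact this.insert_one
  | succ k ih => exact pow_succ (insert 1 S) k ▸ ih.mul hS.insert_one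

theorem LogSparse.hasNaturalDensity_zero {S : Set ℕ} (hS : LogSparse S) :
    HasNaturalDensity S 0 := by
  obtain ⟨C, c, hC⟩ := hS
  have hC0 : 0 ≤ C := by simpa using (Nat.cast_nonneg _).trans (hC 0)
  -- The substitution `y = exp 1 * (m + 1)` turns `1 + log (m + 1)` into `log y`.
  have hlim : Filter.Tendsto (fun y : ℝ => C * Real.exp 1 * (Real.log y ^ c / y))
      Filter.atTop (nhds 0) := by
    simpa using (Real.isLittleO_pow_log_id_atTop (n := c)).tendsto_div_nhds_zero.const_mul
      (C * Real.exp 1)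
  have hy : Filter.Tendsto (fun n : ℕ => Real.exp 1 * ((Nat.log 2 n : ℕ) + 1 : ℝ))
      Filter.atTop Filter.atTop := by
    refine Filter.Tendsto.const_mul_atTop (Real.exp_pos 1)
      (Filter.tendsto_atTop_add_const_right _ _ ?_)
    refine tendsto_natCast_atTop_atTop.comp (Filter.tendsto_atTop.mpr fun b => ?_)
    filter_upwards [Filter.eventually_ge_atTop (2 ^ b)] with n hn
    exact Nat.le_log_of_pow_le (by norm_num) hn
  refine squeeze_zero' (Filter.Eventually.of_forall fun n => by positivity) ?_ (hlim.comp hy)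
  filter_upwards [Filter.eventually_gt_atTop 0] with n hn
  set m := Nat.log 2 n with hm
  have hmn : (2 : ℝ) ^ m ≤ n := by exact_mod_cast Nat.pow_log_le_self 2 hn.ne'
  have hL0 : 0 ≤ Real.log (m + 1) :=
    Real.log_nonneg (by linarith [Nat.cast_nonneg (α := ℝ) m])
  have h1 : ((S ∩ Set.Icc 1 n).ncard : ℝ) ≤ (S ∩ Set.Ioo 0 (2 ^ (m + 1))).ncard := by
    refine Nat.cast_le.mpr (Set.ncard_le_ncard ?_ ((Set.finite_Ioo _ _).inter_of_right _))
    exact fun x ⟨hx, hx1, hxn⟩ =>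
      ⟨hx, hx1, hxn.trans_lt (Nat.lt_pow_succ_log_self (by norm_num) n)⟩
  have h2 : ((S ∩ Set.Icc 1 n).ncard : ℝ) / n ≤
      C * 2 ^ m * (1 + Real.log (m + 1)) ^ c / (m + 1) / 2 ^ m := by
    have := h1.trans (hC m)
    gcongr
  refine h2.trans (le_of_eq ?_)
  simp only [Function.comp_apply, ← hm]
  rw [Real.log_mul (Real.exp_pos 1).ne' (by positivity), Real.log_exp]
  field_simp

/-! ### The generators `q - 1` and the density of their monoid -/

theorem logSparse_prime_pred : LogSparse {m | (m + 1).Prime ∧ 2 ∣ m} := by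
  -- `12 = 8 + 4`: the main term of Chebyshev's bound (`h4`) plus its `√x` term (`h5`).
  refine ⟨12, 0, fun m => ?_⟩
  have hcard : ({m | (m + 1).Prime ∧ 2 ∣ m} ∩ Set.Ioo 0 (2 ^ (m + 1))).ncard ≤
      Nat.primeCounting (2 ^ (m + 1)) := by
    rw [← Nat.primesLE_card_eq_primeCounting, ← Set.ncard_coe_finset]
    refine Set.ncard_le_ncard_of_injOn (· + 1) (fun x hx => ?_) (fun x _ y _ h => by simpa using h)
      (Finset.finite_toSet _)
    exact Nat.mem_primesLE.mpr ⟨hx.2.2, hx.1.1⟩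
  have hx : (1 : ℝ) < 2 ^ (m + 1) := one_lt_pow₀ (by norm_num) (by omega)
  have hpi := Chebyshev.pi_le_log4_mul_div hx
  rw [show (2 : ℝ) ^ (m + 1) = ((2 ^ (m + 1) : ℕ) : ℝ) by push_cast; rfl, Nat.floor_natCast] at hpi
  push_cast at hpi
  have hlog2 : 0 < Real.log 2 := Real.log_pos (by norm_num)
  have h4 : Real.log 4 * 2 ^ (m + 1) / Real.log √(2 ^ (m + 1)) = 8 * 2 ^ m / (m + 1) := by
    rw [Real.log_sqrt (by positivity), Real.log_pow, show (4 : ℝ) = 2 ^ 2 by norm_num,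
      Real.log_pow]
    push_cast
    field_simp
    ring
  have h5 : √(2 ^ (m + 1)) ≤ 4 * 2 ^ m / ((m : ℝ) + 1) := by
    rw [Real.sqrt_le_left (by positivity), div_pow, le_div_iff₀ (by positivity)]
    -- A quadratic above `(k + 1) ^ 2` that at most doubles from `k` to `k + 1`, so that induction
    -- goes through.
    have h6 : ∀ k : ℕ, k ^ 2 + 5 * k + 7 ≤ 8 * 2 ^ k := by
      intro k
      induction k with
      | zero => norm_num
      | succ k ih => rw [pow_succ 2 k]; nlinarith
    have h7 : ((m : ℝ) + 1) ^ 2 ≤ 8 * 2 ^ m := by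
      have h8 : (m + 1) ^ 2 ≤ 8 * 2 ^ m := le_trans (by nlinarith) (h6 m)
      exact_mod_cast h8
    calc (2 : ℝ) ^ (m + 1) * (m + 1) ^ 2 ≤ 2 ^ (m + 1) * (8 * 2 ^ m) := by gcongr
      _ = (4 * 2 ^ m) ^ 2 := by ring
  calc _ ≤ (Nat.primeCounting (2 ^ (m + 1)) : ℝ) := Nat.cast_le.mpr hcard
    _ ≤ 8 * 2 ^ m / (m + 1) + 4 * 2 ^ m / (m + 1) := hpi.trans (add_le_add h4.le h5)
    _ = _ := by ring

theorem summable_one_div_pow_sub_one :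
    Summable fun x : ℕ × ℕ => (1 : ℝ) / ((x.1 + 2) ^ (x.2 + 2) - 1 : ℕ) := by
  have h1 : Summable fun a : ℕ => (1 : ℝ) / ((a + 2 : ℕ) : ℝ) ^ 2 :=
    (summable_nat_add_iff 2).mpr (Real.summable_one_div_nat_pow.mpr (by norm_num))
  have h2 : Summable fun k : ℕ => 2 * (1 / 2 : ℝ) ^ k := summable_geometric_two.mul_left 2
  refine Summable.of_nonneg_of_le (fun _ => by positivity) (fun x => ?_)
    (h1.mul_of_nonneg h2 (fun _ => by positivity) fun _ => by positivity)
  obtain ⟨a, k⟩ := x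
  have h3 : 1 ≤ (a + 2) ^ (k + 2) := Nat.one_le_pow _ _ (by omega)
  -- From `y ≥ 2` follows `y - 1 ≥ y / 2`, which accounts for the factor `2` in `h2`.
  have hpos : (2 : ℝ) ≤ ((a + 2 : ℕ) : ℝ) ^ 2 * 2 ^ k := by
    have h5 : (1 : ℝ) ≤ 2 ^ k := one_le_pow₀ (by norm_num)
    have h6 : (4 : ℝ) ≤ ((a + 2 : ℕ) : ℝ) ^ 2 := by push_cast; nlinarith [Nat.cast_nonneg (α := ℝ) a]
    nlinarith
  have h4 : ((a + 2 : ℕ) : ℝ) ^ 2 * 2 ^ k ≤ ((a + 2 : ℕ) : ℝ) ^ (k + 2) := by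
    rw [pow_add _ k 2, mul_comm]
    gcongr
    push_cast
    linarith [Nat.cast_nonneg (α := ℝ) a]
  simp only
  rw [Nat.cast_sub h3, Nat.cast_pow, Nat.cast_one]
  calc (1 : ℝ) / (((a + 2 : ℕ) : ℝ) ^ (k + 2) - 1)
      ≤ 1 / (((a + 2 : ℕ) : ℝ) ^ 2 * 2 ^ k / 2) := by
        apply one_div_le_one_div_of_le <;> linarith
    _ = _ := by
        rw [one_div_pow]
        field_simp

/-- The multiplicative monoid generated by the numbers `a ^ k - 1` with `a, k ≥ 2`. -/
def perfectPowerPredMonoid : Submonoid ℕ :=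
  Submonoid.closure (Set.range fun x : ℕ × ℕ => (x.1 + 2) ^ (x.2 + 2) - 1)

theorem summable_perfectPowerPredMonoid :
    Summable ((perfectPowerPredMonoid : Set ℕ).indicator fun d : ℕ => (1 : ℝ) / d) := by
  refine Submonoid.summable_closure_range (fun x => ?_) summable_one_div_pow_sub_one
  have : 2 ^ 2 ≤ (x.1 + 2) ^ (x.2 + 2) :=
    (Nat.pow_le_pow_left (by omega) 2).trans (Nat.pow_le_pow_right (by omega) (by omega))
  omega

/-- The prime `2` gives the generator `1`, which can be dropped; this is why the remaining primes
give even generators. -/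
theorem primePowerPredMonoid_le :
    primePowerPredMonoid ≤
      Submonoid.closure {m | (m + 1).Prime ∧ 2 ∣ m} ⊔ perfectPowerPredMonoid := by
  refine Submonoid.closure_le.mpr fun m hm => ?_
  obtain ⟨p, k, hp, hk, hpk⟩ := (isPrimePow_nat_iff _).mp hm
  rcases (by omega : k = 1 ∨ 2 ≤ k) with rfl | hk2
  · rw [pow_one] at hpk
    rcases hp.eq_two_or_odd with h2 | hodd
    · have : m = 1 := by omega
      rw [this]
      exact one_mem _
    · refine Submonoid.mem_sup_left (Submonoid.subset_closure ⟨hpk ▸ hp, ?_⟩)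
      omega
  · refine Submonoid.mem_sup_right (Submonoid.subset_closure ⟨(p - 2, k - 2), ?_⟩)
    have := hp.two_le
    simp only
    rw [Nat.sub_add_cancel this, Nat.sub_add_cancel hk2, hpk, Nat.add_sub_cancel]

/-- A product of `j` even generators is divisible by `2 ^ j`. Inserting `1` makes the set powers
increase, so every `j ≤ K` fits into the `K`-th power. -/
theorem primePowerPredMonoid_subset (K : ℕ) : (primePowerPredMonoid : Set ℕ) ⊆
    insert 1 {m | (m + 1).Prime ∧ 2 ∣ m} ^ K * (perfectPowerPredMonoid : Set ℕ) ∪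
      {n | 2 ^ K ∣ n} := by
  intro n hn
  set P : Set ℕ := {m | (m + 1).Prime ∧ 2 ∣ m} with hP
  obtain ⟨e, he, d, hd, rfl⟩ := Submonoid.mem_sup.mp (primePowerPredMonoid_le hn)
  have hpow : ∃ j, e ∈ insert 1 P ^ j ∧ 2 ^ j ∣ e := by
    clear hn
    induction he using Submonoid.closure_induction with
    | mem x hx => exact ⟨1, by rw [pow_one]; exact Or.inr hx, by simpa using hx.2⟩
    | one => exact ⟨0, by simp, by simp⟩
    | mul x y _ _ hx hy =>
      obtain ⟨i, hi, hi2⟩ := hx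
      obtain ⟨j, hj, hj2⟩ := hy
      exact ⟨i + j, pow_add (insert 1 P) i j ▸ Set.mul_mem_mul hi hj,
        pow_add 2 i j ▸ mul_dvd_mul hi2 hj2⟩
  obtain ⟨j, hj, hj2⟩ := hpow
  rcases le_total j K with h | h
  · exact Or.inl (Set.mul_mem_mul (Set.pow_subset_pow_right (Set.mem_insert 1 P) h hj) hd)
  · exact Or.inr (((pow_dvd_pow 2 h).trans hj2).mul_right d)

theorem ncard_dvd_inter_Icc (r n : ℕ) : ({k | r ∣ k} ∩ Set.Icc 1 n).ncard = n / r := by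
  rw [← Nat.Ioc_filter_dvd_card_eq_div, ← Set.ncard_coe_finset]
  congr 1
  ext k
  simp [Nat.succ_le_iff, and_comm]

theorem hasNaturalDensity_primePowerPredMonoid : HasNaturalDensity primePowerPredMonoid 0 := by
  rw [HasNaturalDensity, Metric.tendsto_atTop']
  intro ε hε
  obtain ⟨K, hK⟩ := exists_pow_lt_of_lt_one (half_pos hε) (by norm_num : (1 / 2 : ℝ) < 1)
  have hE := ((logSparse_prime_pred.pow_insert_one K).hasNaturalDensity_zero).mul_of_summable
    summable_perfectPowerPredMonoid
  -- The primed form yields `n > N`, hence `n > 0` for the divisions below.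
  obtain ⟨N, hN⟩ := (Metric.tendsto_atTop'.mp hE) (ε / 2) (half_pos hε)
  refine ⟨N, fun n hn => ?_⟩
  have h1 := hN n hn
  have hn0 : (0 : ℝ) < n := by exact_mod_cast (Nat.zero_le N).trans_lt hn
  rw [Real.dist_0_eq_abs, abs_of_nonneg (by positivity)] at h1 ⊢
  have hfin : ∀ X : Set ℕ, (X ∩ Set.Icc 1 n).Finite :=
    fun X => (Set.finite_Icc _ _).inter_of_right _
  have h2 := (Set.ncard_le_ncard (Set.inter_subset_inter_left (Set.Icc 1 n)
    (primePowerPredMonoid_subset K)) (hfin _))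
  rw [Set.union_inter_distrib_right] at h2
  have h3 := h2.trans (Set.ncard_union_le _ _)
  rw [ncard_dvd_inter_Icc] at h3
  have h4 : ((n / 2 ^ K : ℕ) : ℝ) / n < ε / 2 := by
    refine lt_of_le_of_lt ?_ hK
    rw [div_le_iff₀ hn0, one_div_pow, one_div_mul_eq_div]
    exact_mod_cast Nat.cast_div_le (α := ℝ) (m := n) (n := 2 ^ K)
  calc _ ≤ _ := div_le_div_of_nonneg_right (Nat.cast_le.mpr h3) hn0.le
    _ < ε := by
      rw [Nat.cast_add, add_div]
      linarith

theorem HasNaturalDensity.mono_zero {X Y : Set ℕ} (hXY : X ⊆ Y) (hY : HasNaturalDensity Y 0) :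
    HasNaturalDensity X 0 := by
  refine squeeze_zero (fun n => by positivity) (fun n => ?_) hY
  gcongr
  exact (Set.finite_Icc _ _).inter_of_right _

theorem propositionA3 : HasNaturalDensity reducedUnitCards.{u} 0 :=
  hasNaturalDensity_primePowerPredMonoid.mono_zero reducedUnitCards_subset
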